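/- Let $\beta>1$ be a real number and let $T_\beta:[0,1)\to[0,1)$ be the $\beta$-transformation $T_\beta x=\beta x \bmod 1$. For $x\in[0,1)$ let $$r_\beta(x):=\sup\{0\le r\le+\infty:\ |T_\beta^n x-x|<(\beta^n)^{-r}\ \text{for infinitely many } n\in\mathbb{N}\}\in[0,+\infty]$$ (with $(\beta^n)^{-\infty}=0$) be its asymptotic recurrence exponent. Then for every $0\le r\le+\infty$, $$\dim_{\rm H}\{x\in[0,1):\ r_\beta(x)=r\}=\frac{1}{1+r},$$ where $\dim_{\rm H}$ is the Hausdorff dimension and $\frac{1}{1+\infty}=0$. -/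

import Mathlib

open scoped ENNReal

namespace BetaRecurrence

noncomputable section

/-- The `β`-transformation `T_β x = β x mod 1` (it maps `[0, 1)` to itself). -/
def betaMap (β : ℝ) (x : ℝ) : ℝ := Int.fract (β * x)

/-- The power `b ^ (-r)` for a real `b > 1` and an exponent `0 ≤ r ≤ +∞`, with the convention
`b ^ (-∞) = 0`. -/
def negPow (b : ℝ) (r : ℝ≥0∞) : ℝ := if r = ∞ then 0 else b ^ (-r.toReal)

/-- The asymptotic recurrence exponent `r_β(x)`: the supremum in `[0, +∞]` of all `0 ≤ r ≤ +∞` such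
that `|T_β^n x - x| < (β^n)^(-r)` for infinitely many `n`. -/
def recurrenceExponent (β : ℝ) (x : ℝ) : ℝ≥0∞ :=
  sSup {r : ℝ≥0∞ | {n : ℕ | |(betaMap β)^[n] x - x| < negPow (β ^ n) r}.Infinite}

end

end BetaRecurrence

/-!
Every `x ∈ [0, 1)` lies in a cylinder of order `n`, whose left endpoint `cylinderLeft β n x` is a
zero of `T_β^n` and on which `T_β^n` is affine with slope `β^n`. The first level at which a zero `a`
of `T_β^n` vanishes carries the combinatorics: if it is `m`, then a full cylinder of order `m`, of
length exactly `β⁻ᵐ`, ends at `a` (`isFullCylinder_sub`). Hence zeros of the same level are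
`β⁻ᵐ`-separated, so that there are `O(n β^n)` cylinders of order `n` (`encard_iterateZeros_le`), and
by the pigeonhole principle every interval longer than `(n + 1) β⁻ⁿ` contains a full cylinder of
order `n` (`exists_isFullCylinder`).

Upper bound. In each cylinder of order `n` the points with `|T_β^n x - x| < β^(-nt)` form a set of
diameter `O(β^(-n(1 + t)))`. Summing over the cylinders of all large orders shows that the points
that return in this way infinitely often are null for the `d`-dimensional Hausdorff measure as soon
as `d > 1 / (1 + t)` (`hausdorffMeasure_returnSet`).

Lower bound. For `0 < r < ∞` and `s = 1 / (1 + r)` it is enough that the points of exponent at least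
`r` have positive `s`-dimensional Hausdorff measure, because by the upper bound those of exponent
greater than `r` are null. Given `τ < r`, split `[0, 1)` into cells of length `δ ≈ n β⁻ⁿ`. Each of
them contains a full cylinder of order `n`, and next to the fixed point of `T_β^n` there lies an
interval of length `ρ ≈ β^(-n(1 + τ))` whose points return at time `n`. Let `q` map each cell
affinely onto its interval. Composing such maps, with `τ` tending to `r` and `n` growing very
fast, and passing to the limit gives `F : [0, 1) → ℝ` whose values have exponent at least `r`. Since
`ρ^s` exceeds `δ` by an arbitrarily large factor, `F` has an inverse that is Hölder of exponent
exactly `s` (`exists_inverse_holder_map`), and so its image has positive `s`-dimensional measure.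
For `r = 0` the identity plays the part of `F`.
-/

namespace BetaRecurrence

/-! ### Cylinders of the `β`-transformation -/

/-- The left endpoint of the cylinder of order `n` containing `x`, that is, of the maximal interval
around `x` on which `T_β^n` is given by one affine branch of slope `β^n`. -/
noncomputable def cylinderLeft (β : ℝ) (n : ℕ) (x : ℝ) : ℝ := x - (betaMap β)^[n] x / β ^ n

theorem iterate_betaMap_mem (β : ℝ) {x : ℝ} (hx : x ∈ Set.Ico (0 : ℝ) 1) (n : ℕ) :
    (betaMap β)^[n] x ∈ Set.Ico (0 : ℝ) 1 := by
  cases n with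
  | zero => simpa using hx
  | succ n =>
    rw [Function.iterate_succ_apply']
    exact ⟨Int.fract_nonneg _, Int.fract_lt_one _⟩

theorem iterate_betaMap_eq {β : ℝ} (hβ : 1 < β) (n : ℕ) (x : ℝ) :
    (betaMap β)^[n] x = β ^ n * (x - cylinderLeft β n x) := by
  have : (0 : ℝ) < β ^ n := by positivity
  unfold cylinderLeft
  field_simp
  ring

theorem cylinderLeft_le {β : ℝ} (hβ : 1 < β) {x : ℝ} (hx : x ∈ Set.Ico (0 : ℝ) 1) (n : ℕ) :
    cylinderLeft β n x ≤ x := by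
  have := div_nonneg (iterate_betaMap_mem β hx n).1 (by positivity : (0 : ℝ) ≤ β ^ n)
  unfold cylinderLeft
  linarith

theorem lt_cylinderLeft_add {β : ℝ} (hβ : 1 < β) {x : ℝ} (hx : x ∈ Set.Ico (0 : ℝ) 1) (n : ℕ) :
    x < cylinderLeft β n x + (β ^ n)⁻¹ := by
  have h0 : (0 : ℝ) < β ^ n := by positivity
  have := (div_lt_div_iff_of_pos_right h0).2 (iterate_betaMap_mem β hx n).2
  unfold cylinderLeft
  rw [one_div] at this
  linarith

/-- Between the left endpoint of its cylinder and `x` itself, `T_β^n` is affine of slope `β^n`. -/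
theorem cylinderLeft_nonneg_and_iterate_eq {β : ℝ} (hβ : 1 < β) {x : ℝ}
    (hx : x ∈ Set.Ico (0 : ℝ) 1) (n : ℕ) :
    0 ≤ cylinderLeft β n x ∧ ∀ y ∈ Set.Icc (cylinderLeft β n x) x,
      (betaMap β)^[n] y = β ^ n * (y - cylinderLeft β n x) := by
  induction n with
  | zero => simp [cylinderLeft]
  | succ n ih =>
    obtain ⟨h0, ih⟩ := ih
    have hb : (0 : ℝ) < β ^ n := by positivity
    have hβ0 : (0 : ℝ) < β := by linarith
    have hTx := iterate_betaMap_mem β hx n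
    set a := cylinderLeft β n x with ha
    set a' := cylinderLeft β (n + 1) x with ha'
    have hxa : (betaMap β)^[n] x = β ^ n * (x - a) := iterate_betaMap_eq hβ n x
    set k : ℤ := ⌊β * (β ^ n * (x - a))⌋ with hk
    have hk0 : (0 : ℝ) ≤ k := by
      have : 0 ≤ k := Int.floor_nonneg.2 (by rw [← hxa]; exact mul_nonneg hβ0.le hTx.1)
      exact_mod_cast this
    have hbk : β ^ n * β * (a' - a) = k := by
      have h1 : (betaMap β)^[n + 1] x = β * (β ^ n * (x - a)) - k := by
        rw [Function.iterate_succ_apply', hxa]; rfl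
      have h2 := iterate_betaMap_eq hβ (n + 1) x
      rw [h1, ← ha', pow_succ] at h2
      linarith
    have haa' : a ≤ a' := by
      by_contra h
      have : β ^ n * β * (a' - a) < 0 := mul_neg_of_pos_of_neg (by positivity) (by linarith)
      linarith
    refine ⟨h0.trans haa', fun y hy => ?_⟩
    rw [Function.iterate_succ_apply', ih y ⟨haa'.trans hy.1, hy.2⟩]
    -- `T_β^n` increases on `[a', x]`, so the integer part of `β T_β^n` there is that at `x`
    have hfl : ⌊β * (β ^ n * (y - a))⌋ = k := by
      rw [Int.floor_eq_iff]
      have h1 : β ^ n * β * (a' - a) ≤ β ^ n * β * (y - a) :=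
        mul_le_mul_of_nonneg_left (by linarith [hy.1]) (by positivity)
      have h2 : β ^ n * β * (y - a) ≤ β ^ n * β * (x - a) :=
        mul_le_mul_of_nonneg_left (by linarith [hy.2]) (by positivity)
      have h3 := Int.lt_floor_add_one (β * (β ^ n * (x - a)))
      rw [← hk] at h3
      constructor <;> nlinarith
    unfold betaMap Int.fract
    rw [hfl, ← hbk, pow_succ]
    ring

/-- The left endpoint of a cylinder of order `n` is a zero of `T_β^n`. -/
theorem iterate_cylinderLeft {β : ℝ} (hβ : 1 < β) {x : ℝ} (hx : x ∈ Set.Ico (0 : ℝ) 1) (n : ℕ) :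
    (betaMap β)^[n] (cylinderLeft β n x) = 0 := by
  rw [(cylinderLeft_nonneg_and_iterate_eq hβ hx n).2 _ ⟨le_rfl, cylinderLeft_le hβ hx n⟩]
  simp

/-- A half-open interval `[a, a + β⁻ⁿ)` on which `T_β^n` is the affine bijection onto `[0, 1)`,
that is, a cylinder of order `n` of maximal length. -/
def IsFullCylinder (β : ℝ) (n : ℕ) (a : ℝ) : Prop :=
  ∀ x ∈ Set.Ico a (a + (β ^ n)⁻¹), (betaMap β)^[n] x = β ^ n * (x - a)

/-- If `a` is a zero of `T_β^(m+1)` but not of `T_β^m`, then the cylinder of order `m + 1` ending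
at `a` is full: the graph of `T_β^(m+1)` jumps down at `a` from `1` to `0`. -/
theorem isFullCylinder_sub {β : ℝ} (hβ : 1 < β) {a : ℝ} (ha : a ∈ Set.Ico (0 : ℝ) 1) {m : ℕ}
    (h0 : (betaMap β)^[m + 1] a = 0) (h1 : (betaMap β)^[m] a ≠ 0) :
    0 ≤ a - (β ^ (m + 1))⁻¹ ∧ IsFullCylinder β (m + 1) (a - (β ^ (m + 1))⁻¹) := by
  have hβ0 : (0 : ℝ) < β := by linarith
  have hb : (0 : ℝ) < β ^ m := by positivity
  have hb' : (0 : ℝ) < β ^ (m + 1) := by positivity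
  obtain ⟨hc0, hc⟩ := cylinderLeft_nonneg_and_iterate_eq hβ ha m
  set c := cylinderLeft β m a
  have hw : (betaMap β)^[m] a = β ^ m * (a - c) := iterate_betaMap_eq hβ m a
  have hwpos : 0 < (betaMap β)^[m] a :=
    lt_of_le_of_ne (iterate_betaMap_mem β ha m).1 (Ne.symm h1)
  obtain ⟨k, hk⟩ : ∃ k : ℤ, β * (β ^ m * (a - c)) = k := by
    rw [Function.iterate_succ_apply', hw] at h0
    exact ⟨_, (Int.fract_eq_zero_iff.1 h0).choose_spec.symm⟩
  have hk1 : (1 : ℝ) ≤ k := by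
    have : (0 : ℝ) < k := by rw [← hk, ← hw]; positivity
    exact_mod_cast (Int.add_one_le_iff.2 (by exact_mod_cast this) : (0 : ℤ) + 1 ≤ k)
  have hinv : β ^ (m + 1) * (β ^ (m + 1))⁻¹ = 1 := mul_inv_cancel₀ hb'.ne'
  have hle : c ≤ a - (β ^ (m + 1))⁻¹ := by
    have : β ^ (m + 1) * (c + (β ^ (m + 1))⁻¹) ≤ β ^ (m + 1) * a := by
      rw [mul_add, hinv, pow_succ]; nlinarith
    linarith [le_of_mul_le_mul_left this hb']
  refine ⟨hc0.trans hle, fun x hx => ?_⟩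
  have hxa : x < a := by linarith [hx.2]
  rw [Function.iterate_succ_apply', hc x ⟨hle.trans hx.1, hxa.le⟩]
  have hval : β * (β ^ m * (x - c)) = k - β ^ (m + 1) * (a - x) := by
    rw [← hk, pow_succ]; ring
  have hfl : ⌊β * (β ^ m * (x - c))⌋ = k - 1 := by
    rw [hval, Int.floor_eq_iff]
    have h2 : β ^ (m + 1) * (a - x) ≤ 1 := by
      rw [← hinv]; exact mul_le_mul_of_nonneg_left (by linarith [hx.1]) hb'.le
    have h3 : 0 < β ^ (m + 1) * (a - x) := mul_pos hb' (by linarith)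
    push_cast
    constructor <;> linarith
  unfold betaMap Int.fract
  rw [hfl, hval]
  push_cast
  linarith

/-- A full cylinder begins with a full cylinder of every higher order. -/
theorem IsFullCylinder.mono {β : ℝ} (hβ : 1 < β) {m n : ℕ} (hmn : m ≤ n) {a : ℝ}
    (h : IsFullCylinder β m a) : IsFullCylinder β n a := by
  induction n, hmn using Nat.le_induction with
  | base => exact h
  | succ n _ ih =>
    intro x hx
    have hβ0 : (0 : ℝ) < β := by linarith
    have hb' : (0 : ℝ) < β ^ (n + 1) := by positivity
    have hx1 : β ^ (n + 1) * (x - a) < 1 := by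
      rw [← mul_inv_cancel₀ hb'.ne']; exact mul_lt_mul_of_pos_left (by linarith [hx.2]) hb'
    have hlt : (β ^ (n + 1))⁻¹ ≤ (β ^ n)⁻¹ :=
      inv_anti₀ (by positivity) (pow_le_pow_right₀ hβ.le (Nat.le_succ n))
    rw [Function.iterate_succ_apply', ih x ⟨hx.1, by linarith [hx.2]⟩]
    have hval : β * (β ^ n * (x - a)) = β ^ (n + 1) * (x - a) := by rw [pow_succ]; ring
    unfold betaMap
    rw [hval, Int.fract_eq_self]
    exact ⟨mul_nonneg hb'.le (by linarith [hx.1]), hx1⟩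

/-- The first `m` with `T_β^m a = 0` (and `0` if there is none). -/
noncomputable def zeroLevel (β a : ℝ) : ℕ := sInf {m | (betaMap β)^[m] a = 0}

theorem iterate_zeroLevel {β a : ℝ} {n : ℕ} (h : (betaMap β)^[n] a = 0) :
    (betaMap β)^[zeroLevel β a] a = 0 :=
  Nat.sInf_mem (s := {m | (betaMap β)^[m] a = 0}) ⟨n, h⟩

theorem zeroLevel_le {β a : ℝ} {n : ℕ} (h : (betaMap β)^[n] a = 0) : zeroLevel β a ≤ n :=
  Nat.sInf_le h

/-- Two zeros of iterates of `T_β` with the same first time `m` of vanishing are at distance at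
least `β⁻ᵐ`, because a full cylinder of order `m` ends at each of them. -/
theorem zeroLevel_separated {β : ℝ} (hβ : 1 < β) {a b : ℝ}
    (hb : b ∈ Set.Ico (0 : ℝ) 1) {n : ℕ} (hna : (betaMap β)^[n] a = 0)
    (hnb : (betaMap β)^[n] b = 0) (hab : a < b) (hl : zeroLevel β a = zeroLevel β b) :
    a ≤ b - (β ^ zeroLevel β b)⁻¹ ∧ IsFullCylinder β (zeroLevel β b)
      (b - (β ^ zeroLevel β b)⁻¹) := by
  have h0 := iterate_zeroLevel hnb
  have ha0 := iterate_zeroLevel hna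
  rw [hl] at ha0
  have hmin : ∀ m, (betaMap β)^[m] b = 0 → zeroLevel β b ≤ m := fun m h => zeroLevel_le h
  generalize zeroLevel β b = m at *
  cases m with
  | zero =>
    simp only [Function.iterate_zero, id] at h0 ha0
    linarith
  | succ m =>
    obtain ⟨-, hfull⟩ := isFullCylinder_sub hβ hb h0 fun h => by have := hmin m h; omega
    refine ⟨?_, hfull⟩
    by_contra! hlt
    have := hfull a ⟨hlt.le, by linarith⟩
    rw [ha0] at this
    exact absurd this.symm (mul_pos (by positivity) (by linarith)).ne'

/-- The zeros of `T_β^n` in `[0, 1)`, which are the left endpoints of the cylinders of order `n`. -/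
def iterateZeros (β : ℝ) (n : ℕ) : Set ℝ := {a | a ∈ Set.Ico (0 : ℝ) 1 ∧ (betaMap β)^[n] a = 0}

/-- There are `O(n β^n)` cylinders of order `n`: the zeros of first level `m ≤ n` are separated by
`β⁻ᵐ`, so that the level and `⌊a β^m⌋` determine `a`. -/
theorem encard_iterateZeros_le {β : ℝ} (hβ : 1 < β) (n : ℕ) :
    (iterateZeros β n).encard ≤ ((n + 1) * (⌊β ^ n⌋₊ + 1) : ℕ) := by
  let f : ℝ → ℕ × ℕ := fun a => (zeroLevel β a, ⌊a * β ^ zeroLevel β a⌋₊)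
  have hinj : Set.InjOn f (iterateZeros β n) := by
    have key : ∀ a ∈ iterateZeros β n, ∀ b ∈ iterateZeros β n, a < b → f a ≠ f b := by
      rintro a ⟨ha, hna⟩ b ⟨hb, hnb⟩ hab heq
      simp only [f, Prod.mk.injEq] at heq
      obtain ⟨hl, hfl⟩ := heq
      have hsep := (zeroLevel_separated hβ hb hna hnb hab hl).1
      rw [hl] at hfl
      have hp : (0 : ℝ) < β ^ zeroLevel β b := by positivity
      have h1 := Nat.lt_floor_add_one (a * β ^ zeroLevel β b)
      have h2 := Nat.floor_le (mul_nonneg hb.1 hp.le)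
      rw [hfl] at h1
      have h3 : (a + (β ^ zeroLevel β b)⁻¹) * β ^ zeroLevel β b ≤ b * β ^ zeroLevel β b :=
        mul_le_mul_of_nonneg_right (by linarith) hp.le
      rw [add_mul, inv_mul_cancel₀ hp.ne'] at h3
      have h4 := Nat.floor_le (mul_nonneg ha.1 hp.le)
      have h5 := Nat.lt_floor_add_one (b * β ^ zeroLevel β b)
      rw [← hfl] at h5
      rw [hfl] at h4 h5
      have : a * β ^ zeroLevel β b + 1 ≤ b * β ^ zeroLevel β b := h3
      have h6 : ⌊a * β ^ zeroLevel β b⌋₊ + 1 ≤ ⌊b * β ^ zeroLevel β b⌋₊ := by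
        rw [← Nat.floor_add_one (mul_nonneg ha.1 hp.le)]
        exact Nat.floor_le_floor this
      omega
    intro a ha b hb hab
    rcases lt_trichotomy a b with h | h | h
    · exact absurd hab (key a ha b hb h)
    · exact h
    · exact absurd hab.symm (key b hb a ha h)
  have hmaps : f '' iterateZeros β n ⊆
      ((Finset.range (n + 1) ×ˢ Finset.range (⌊β ^ n⌋₊ + 1) : Finset (ℕ × ℕ)) : Set (ℕ × ℕ)) := by
    rintro _ ⟨a, ⟨ha, hna⟩, rfl⟩
    have hle := zeroLevel_le hna
    simp only [f, Finset.coe_product, Finset.coe_range, Set.mem_prod, Set.mem_Iio]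
    refine ⟨by omega, Nat.lt_succ_of_le (Nat.floor_le_floor ?_)⟩
    calc a * β ^ zeroLevel β a ≤ 1 * β ^ n :=
          mul_le_mul ha.2.le (pow_le_pow_right₀ hβ.le hle) (by positivity) zero_le_one
      _ = β ^ n := one_mul _
  rw [← hinj.encard_image]
  refine (Set.encard_le_encard hmaps).trans ?_
  rw [Set.encard_coe_eq_coe_finsetCard]
  simp

/-- An interval in `[0, 1]` of length more than `(n + 1) β⁻ⁿ` contains a full cylinder of order `n`:
it contains `n + 1` distinct zeros of `T_β^n`, none of them `0`, and two of them must vanish for the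
first time at the same level. -/
theorem exists_isFullCylinder {β : ℝ} (hβ : 1 < β) (n : ℕ) {u v : ℝ} (hu : 0 ≤ u) (hv : v ≤ 1)
    (huv : (n + 1) * (β ^ n)⁻¹ < v - u) :
    ∃ a, u ≤ a ∧ a + (β ^ n)⁻¹ ≤ v ∧ IsFullCylinder β n a := by
  have hd : (0 : ℝ) < (β ^ n)⁻¹ := by positivity
  set d := (β ^ n)⁻¹ with hddef
  -- points spaced by `d` lie in different cylinders, since these have length at most `d`
  let x : ℕ → ℝ := fun j => u + (j + 1) * d
  have hx : ∀ j ∈ Finset.range (n + 1), x j ∈ Set.Ico (0 : ℝ) 1 ∧ x j < v := by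
    intro j hj
    have hj' : (j : ℝ) ≤ n := by exact_mod_cast Nat.lt_succ_iff.1 (Finset.mem_range.1 hj)
    have h1 : ((j : ℝ) + 1) * d ≤ (n + 1) * d := mul_le_mul_of_nonneg_right (by linarith) hd.le
    have h2 : 0 ≤ ((j : ℝ) + 1) * d := by positivity
    exact ⟨⟨by simp only [x]; linarith, by simp only [x]; linarith⟩, by simp only [x]; linarith⟩
  let b : ℕ → ℝ := fun j => cylinderLeft β n (x j)
  have hb : ∀ j ∈ Finset.range (n + 1), u < b j ∧ x j - d < b j ∧ b j ≤ x j ∧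
      b j ∈ Set.Ico (0 : ℝ) 1 ∧ (betaMap β)^[n] (b j) = 0 := by
    intro j hj
    have h1 := cylinderLeft_le hβ (hx j hj).1 n
    have h2 := lt_cylinderLeft_add hβ (hx j hj).1 n
    have h3 : u ≤ x j - d := by
      have : 0 ≤ (j : ℝ) * d := by positivity
      simp only [x]; linarith
    have h4 : u < b j := by simp only [b]; linarith
    exact ⟨h4, by simp only [b]; linarith, h1, ⟨by linarith, by
      simp only [b]; linarith [(hx j hj).1.2]⟩, iterate_cylinderLeft hβ (hx j hj).1 n⟩
  have hmem : ∀ j ∈ Finset.range (n + 1), zeroLevel β (b j) ∈ Finset.Icc 1 n := by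
    intro j hj
    obtain ⟨h1, -, -, -, h5⟩ := hb j hj
    refine Finset.mem_Icc.2 ⟨Nat.one_le_iff_ne_zero.2 fun h => ?_, zeroLevel_le h5⟩
    have := iterate_zeroLevel h5
    rw [h] at this
    simp only [Function.iterate_zero, id] at this
    linarith
  obtain ⟨i, hi, j, hj, hij, hl⟩ := Finset.exists_ne_map_eq_of_card_lt_of_maps_to
    (s := Finset.range (n + 1)) (t := Finset.Icc 1 n) (by simp) hmem
  wlog hlt : i < j generalizing i j
  · exact this j hj i hi hij.symm hl.symm (by omega)
  have hbb : b i < b j := by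
    have h1 := (hb i hi).2.2.1
    have h2 := (hb j hj).2.1
    have h3 : ((i : ℝ) + 1) * d ≤ j * d :=
      mul_le_mul_of_nonneg_right (by exact_mod_cast hlt) hd.le
    simp only [x] at h1 h2
    linarith
  obtain ⟨h1, h2⟩ := zeroLevel_separated hβ (hb j hj).2.2.2.1
    (hb i hi).2.2.2.2 (hb j hj).2.2.2.2 hbb hl
  have hle : zeroLevel β (b j) ≤ n := zeroLevel_le (hb j hj).2.2.2.2
  refine ⟨_, (hb i hi).1.le.trans h1, ?_, h2.mono hβ hle⟩
  have h3 : d ≤ (β ^ zeroLevel β (b j))⁻¹ :=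
    inv_anti₀ (by positivity) (pow_le_pow_right₀ hβ.le hle)
  linarith [(hb j hj).2.2.1, (hx j hj).2]

/-! ### The upper bound -/

open MeasureTheory Filter Topology

/-- The points `x ∈ [0, 1)` that return infinitely often: `|T_β^n x - x| < β^(-nt)` for infinitely
many `n`. -/
def returnSet (β t : ℝ) : Set ℝ :=
  {x | x ∈ Set.Ico (0 : ℝ) 1 ∧ {n : ℕ | |(betaMap β)^[n] x - x| < (β ^ n) ^ (-t)}.Infinite}

/-- The points of the cylinder of order `n` with left endpoint `a` that return at time `n`. -/
def returnPiece (β t : ℝ) (n : ℕ) (a : ℝ) : Set ℝ :=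
  {x | x ∈ Set.Ico (0 : ℝ) 1 ∧ |(betaMap β)^[n] x - x| < (β ^ n) ^ (-t) ∧ cylinderLeft β n x = a}

/-- On a cylinder of order `n` the map `T_β^n x - x` is affine with slope `β^n - 1`. -/
theorem ediam_returnPiece_le {β : ℝ} (hβ : 1 < β) (t : ℝ) {n : ℕ} (hn : 1 ≤ n) (a : ℝ) :
    Metric.ediam (returnPiece β t n a) ≤
      ENNReal.ofReal (2 * β / (β - 1) * (β ^ n) ^ (-(1 + t))) := by
  have hB : (0 : ℝ) < β ^ n := by positivity
  refine Metric.ediam_le fun x hx y hy => ?_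
  rw [edist_dist, Real.dist_eq]
  refine ENNReal.ofReal_le_ofReal ?_
  have hx1 := iterate_betaMap_eq hβ n x
  have hy1 := iterate_betaMap_eq hβ n y
  rw [hx.2.2] at hx1
  rw [hy.2.2] at hy1
  have hβB : β ≤ β ^ n := le_self_pow₀ hβ.le (by omega)
  have h1 : (β ^ n - 1) * |x - y| ≤ 2 * (β ^ n) ^ (-t) := by
    rw [← abs_of_pos (by linarith : (0 : ℝ) < β ^ n - 1), ← abs_mul,
      show (β ^ n - 1) * (x - y) = ((betaMap β)^[n] x - x) - ((betaMap β)^[n] y - y) by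
        rw [hx1, hy1]; ring]
    exact (abs_sub _ _).trans (by linarith [hx.2.1, hy.2.1])
  have h2 : (β - 1) * β ^ n ≤ β * (β ^ n - 1) := by linarith
  have h3 : (β - 1) * β ^ n * |x - y| ≤ β * (2 * (β ^ n) ^ (-t)) := by
    calc _ ≤ β * (β ^ n - 1) * |x - y| := mul_le_mul_of_nonneg_right h2 (abs_nonneg _)
      _ = β * ((β ^ n - 1) * |x - y|) := by ring
      _ ≤ _ := mul_le_mul_of_nonneg_left h1 (by linarith)
  rw [neg_add, Real.rpow_add hB, Real.rpow_neg_one]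
  rw [div_mul_eq_mul_div, le_div_iff₀ (by linarith)]
  have h4 : |x - y| * (β - 1) = (β - 1) * β ^ n * |x - y| * (β ^ n)⁻¹ := by
    field_simp
  rw [h4]
  calc _ ≤ β * (2 * (β ^ n) ^ (-t)) * (β ^ n)⁻¹ :=
        mul_le_mul_of_nonneg_right h3 (by positivity)
    _ = _ := by ring

/-- The upper bound: cover by the pieces of all orders `n ≥ N`, of which there are about `n β^n` of
order `n`, each of diameter at most a constant times `β^(-n(1+t))`. -/
theorem hausdorffMeasure_returnSet {β : ℝ} (hβ : 1 < β) {t d : ℝ} (ht : 0 ≤ t)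
    (hd : 1 < (1 + t) * d) : μH[d] (returnSet β t) = 0 := by
  have hd0 : 0 < d := by
    by_contra! h
    linarith [mul_nonpos_of_nonneg_of_nonpos (by linarith : 0 ≤ 1 + t) h]
  have hβ0 : 0 < β := by linarith
  set C := 2 * β / (β - 1) with hC
  have hC0 : 0 < C := div_pos (by linarith) (by linarith)
  set γ := β ^ (1 - (1 + t) * d) with hγ
  have hγ0 : 0 < γ := Real.rpow_pos_of_pos hβ0 _
  have hγ1 : γ < 1 := Real.rpow_lt_one_of_one_lt_of_neg hβ (by linarith)
  let f : ℕ → ℝ := fun n => 2 * C ^ d * ((n + 1) * γ ^ n)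
  have hfs : Summable f := by
    refine Summable.mul_left _ ?_
    have h1 := summable_pow_mul_geometric_of_norm_lt_one 1
      (show ‖γ‖ < 1 by rwa [Real.norm_of_nonneg hγ0.le])
    have h2 := summable_geometric_of_lt_one hγ0.le hγ1
    exact (h1.add h2).congr fun n => by ring
  have hdiam0 : Tendsto (fun n : ℕ => ENNReal.ofReal (C * (β ^ (n + 1))⁻¹)) atTop (𝓝 0) := by
    have h1 : Tendsto (fun n : ℕ => C * (β ^ (n + 1))⁻¹) atTop (𝓝 (C * 0)) :=
      ((tendsto_pow_atTop_atTop_of_one_lt hβ).comp (tendsto_add_atTop_nat 1)).inv_tendsto_atTop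
        |>.const_mul C
    rw [mul_zero] at h1
    simpa using ENNReal.tendsto_ofReal h1
  have hpiece : ∀ n, 1 ≤ n → ∑' a : iterateZeros β n, Metric.ediam (returnPiece β t n a) ^ d ≤
      ENNReal.ofReal (f n) := by
    intro n hn
    have hB : (0 : ℝ) < β ^ n := by positivity
    calc ∑' a : iterateZeros β n, Metric.ediam (returnPiece β t n a) ^ d
        ≤ ∑' _ : iterateZeros β n, ENNReal.ofReal ((C * (β ^ n) ^ (-(1 + t))) ^ d) := by
          refine ENNReal.tsum_le_tsum fun a => ?_
          rw [← ENNReal.ofReal_rpow_of_nonneg (by positivity) hd0.le]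
          exact ENNReal.rpow_le_rpow (ediam_returnPiece_le hβ t hn a) hd0.le
      _ = (iterateZeros β n).encard * ENNReal.ofReal ((C * (β ^ n) ^ (-(1 + t))) ^ d) :=
          ENNReal.tsum_set_const _ _
      _ ≤ ENNReal.ofReal ((n + 1) * (2 * β ^ n)) *
            ENNReal.ofReal ((C * (β ^ n) ^ (-(1 + t))) ^ d) := by
          refine mul_le_mul_left ?_ _
          have h1 : ((iterateZeros β n).encard : ℝ≥0∞) ≤
              (((n + 1) * (⌊β ^ n⌋₊ + 1) : ℕ) : ℝ≥0∞) := by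
            exact_mod_cast ENat.toENNReal_le.2 (encard_iterateZeros_le hβ n)
          refine h1.trans ?_
          rw [← ENNReal.ofReal_natCast]
          refine ENNReal.ofReal_le_ofReal ?_
          push_cast
          have h2 := Nat.floor_le hB.le
          have h3 : 1 ≤ β ^ n := one_le_pow₀ hβ.le
          exact mul_le_mul_of_nonneg_left (by linarith) (by positivity)
      _ = ENNReal.ofReal (f n) := by
          rw [← ENNReal.ofReal_mul (by positivity)]
          congr 1
          have h1 : ((β ^ n) ^ (-(1 + t))) ^ d * β ^ n = γ ^ n := by
            rw [← Real.rpow_mul hB.le, ← Real.rpow_add_one hB.ne', hγ, ← Real.rpow_natCast,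
              ← Real.rpow_natCast, ← Real.rpow_mul hβ0.le, ← Real.rpow_mul hβ0.le]
            congr 1
            ring
          rw [Real.mul_rpow hC0.le (by positivity)]
          simp only [f]
          rw [← h1]
          ring
  have hcount : ∀ n, Countable (iterateZeros β n) := fun n =>
    (Set.finite_of_encard_le_coe (encard_iterateZeros_le hβ n)).countable.to_subtype
  let t' : ∀ N : ℕ, (Σ n : ℕ, iterateZeros β (n + (N + 1))) → Set ℝ :=
    fun N p => returnPiece β t (p.1 + (N + 1)) p.2
  have hle := Measure.hausdorffMeasure_le_liminf_tsum d (returnSet β t) (l := atTop)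
    (fun n : ℕ => ENNReal.ofReal (C * (β ^ (n + 1))⁻¹)) hdiam0 t'
    (Eventually.of_forall ?_) (Eventually.of_forall ?_)
  · refine le_antisymm (hle.trans ?_) zero_le
    have hlim : Tendsto (fun N => ∑' p, Metric.ediam (t' N p) ^ d) atTop (𝓝 0) := by
      have h1 := (ENNReal.tendsto_sum_nat_add (fun n => ENNReal.ofReal (f n))
        hfs.tsum_ofReal_ne_top).comp (tendsto_add_atTop_nat 1)
      refine tendsto_of_tendsto_of_tendsto_of_le_of_le tendsto_const_nhds h1
        (fun _ => zero_le) fun N => ?_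
      rw [ENNReal.tsum_sigma']
      exact ENNReal.tsum_le_tsum fun n => hpiece _ (by omega)
    exact hlim.liminf_eq.le
  · rintro N ⟨n, a⟩
    refine (ediam_returnPiece_le hβ t (by omega) _).trans (ENNReal.ofReal_le_ofReal ?_)
    refine mul_le_mul_of_nonneg_left ?_ hC0.le
    have h1 : (1 : ℝ) ≤ β ^ (n + (N + 1)) := one_le_pow₀ hβ.le
    calc (β ^ (n + (N + 1))) ^ (-(1 + t)) ≤ (β ^ (n + (N + 1))) ^ (-1 : ℝ) :=
          Real.rpow_le_rpow_of_exponent_le h1 (by linarith)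
      _ = (β ^ (n + (N + 1)))⁻¹ := Real.rpow_neg_one _
      _ ≤ _ := inv_anti₀ (by positivity) (pow_le_pow_right₀ hβ.le (by omega))
  · rintro N x ⟨hx, hinf⟩
    obtain ⟨n, hn, hNn⟩ := hinf.exists_gt N
    obtain ⟨k, rfl⟩ : ∃ k, n = k + (N + 1) := ⟨n - (N + 1), by omega⟩
    refine Set.mem_iUnion.2 ⟨⟨k, cylinderLeft β (k + (N + 1)) x, ⟨?_, ?_⟩, ?_⟩, hx, hn, rfl⟩
    · exact (cylinderLeft_nonneg_and_iterate_eq hβ hx _).1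
    · exact (cylinderLeft_le hβ hx _).trans_lt hx.2
    · exact iterate_cylinderLeft hβ hx _

/-! ### Infinite compositions of concentrations -/

/-- `q` moves each point of `[0, 1)` by at most `δ` to the centre of a ball of radius `ρ` inside
`E`, and contracts distances at most by the factor `ρ / δ`. Thus `q` is a right inverse of a map
that is constant away from the balls and stretches each of them over an interval of length about
`δ`. -/
def IsConcentration (E : Set ℝ) (δ ρ : ℝ) (q : ℝ → ℝ) : Prop :=
  ∀ y ∈ Set.Ico (0 : ℝ) 1, q y ∈ Set.Ico (0 : ℝ) 1 ∧ |q y - y| ≤ δ ∧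
    Metric.closedBall (q y) ρ ⊆ E ∧ ∀ y' ∈ Set.Ico (0 : ℝ) 1, ρ * |y - y'| ≤ δ * |q y - q y'|

/-- How composing with one more concentration affects an inverse Hölder bound: `D`, `e`, `d` are the
distances of two points originally, before and after the last step. The Hölder constant grows only
from `C` to `C'` if `δ` is small compared with `ρ^s`: for `d` much larger than `δ` the last step
hardly matters, for smaller `d` the Lipschitz bound `L` is better than the Hölder bound. -/
theorem le_mul_rpow_of_concentration {s L C C' δ ρ D e d : ℝ} (hs0 : 0 < s) (hs1 : s ≤ 1)
    (hL : 0 ≤ L) (hC : 0 < C) (hCC : C < C') (hC1 : 1 ≤ C') (hρ : 0 < ρ) (hρδ : ρ ≤ δ)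
    (hδ : L * (2 * C / (C' - C) + 2) * δ ≤ ρ ^ s) (he : 0 ≤ e) (hd : 0 ≤ d)
    (h1 : ρ * e ≤ δ * d) (h2 : e ≤ d + 2 * δ) (hDL : D ≤ L * e) (hDC : D ≤ C * e ^ s) :
    D ≤ C' * d ^ s := by
  have hδ0 : 0 < δ := hρ.trans_le hρδ
  have hC'C : 0 < C' - C := by linarith
  set B := 2 * C / (C' - C) with hB
  have hB0 : 0 < B := by positivity
  have hBeq : B * (C' - C) = 2 * C := by rw [hB]; field_simp
  by_cases hdB : B * δ ≤ d
  · have hle : e ≤ d * (C' / C) := by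
      rw [mul_div_assoc', le_div_iff₀ hC]
      have h3 : 2 * C * δ ≤ d * (C' - C) := by
        rw [← hBeq]; nlinarith
      nlinarith
    have hCC1 : 1 ≤ C' / C := (one_le_div hC).2 hCC.le
    calc D ≤ C * e ^ s := hDC
      _ ≤ C * (d * (C' / C)) ^ s :=
          mul_le_mul_of_nonneg_left (Real.rpow_le_rpow he hle hs0.le) hC.le
      _ = C * (d ^ s * (C' / C) ^ s) := by rw [Real.mul_rpow hd (by positivity)]
      _ ≤ C * (d ^ s * (C' / C) ^ (1 : ℝ)) := by
          gcongr
      _ = C' * d ^ s := by rw [Real.rpow_one]; field_simp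
  · push Not at hdB
    suffices h : D ≤ 1 * d ^ s from
      h.trans (mul_le_mul_of_nonneg_right hC1 (Real.rpow_nonneg hd s))
    rw [one_mul]
    by_cases hdρ : ρ ≤ d
    · calc D ≤ L * e := hDL
        _ ≤ L * ((B + 2) * δ) := mul_le_mul_of_nonneg_left (by linarith) hL
        _ = L * (B + 2) * δ := by ring
        _ ≤ ρ ^ s := hδ
        _ ≤ d ^ s := Real.rpow_le_rpow hρ.le hdρ hs0.le
    · push Not at hdρ
      have hfrac : d / ρ ≤ (d / ρ) ^ s := by
        rcases hd.eq_or_lt with rfl | hd0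
        · simp [Real.zero_rpow hs0.ne']
        · conv_lhs => rw [← Real.rpow_one (d / ρ)]
          exact Real.rpow_le_rpow_of_exponent_ge (by positivity) ((div_le_one hρ).2 hdρ.le) hs1
      have he' : e ≤ δ * (d / ρ) := by
        rw [mul_div_assoc', le_div_iff₀ hρ]; linarith
      calc D ≤ L * e := hDL
        _ ≤ L * (δ * (d / ρ)) := mul_le_mul_of_nonneg_left he' hL
        _ = L * 1 * δ * (d / ρ) := by ring
        _ ≤ L * (B + 2) * δ * (d / ρ) := by gcongr; linarith
        _ ≤ ρ ^ s * (d / ρ) ^ s := mul_le_mul hδ hfrac (by positivity) (by positivity)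
        _ = d ^ s := by
            rw [← Real.mul_rpow hρ.le (by positivity)]
            congr 1
            field_simp

/-- If each `E k` admits concentrations of arbitrarily fine scale `δ`, with radii `ρ` such that
`ρ^s` exceeds any prescribed multiple of `δ`, then an infinite composition of concentrations maps
`[0, 1)` into `⋂ k, E k`, with an inverse that is Hölder of exponent exactly `s`. -/
theorem exists_inverse_holder_map {s : ℝ} (hs0 : 0 < s) (hs1 : s ≤ 1) (E : ℕ → Set ℝ)
    (hE : ∀ k Λ ε, 0 < ε → ∃ δ ρ q, 0 < ρ ∧ ρ ≤ δ ∧ δ ≤ ε ∧ Λ * δ ≤ ρ ^ s ∧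
      IsConcentration (E k) δ ρ q) :
    ∃ F : ℝ → ℝ, ∀ y ∈ Set.Ico (0 : ℝ) 1, (∀ k, F y ∈ E k) ∧
      ∀ y' ∈ Set.Ico (0 : ℝ) 1, |y - y'| ≤ 2 * |F y - F y'| ^ s := by
  -- a stage `(z, L, ρ)`: the composition so far, the Lipschitz constant of its inverse, the last
  -- radius; the Hölder constants `2 - 2⁻ᵏ` increase strictly but stay bounded
  let P : ℕ → (ℝ → ℝ) × ℝ × ℝ → Prop := fun k x => 0 < x.2.2 ∧ 0 ≤ x.2.1 ∧
    ∀ y ∈ Set.Ico (0 : ℝ) 1, x.1 y ∈ Set.Ico (0 : ℝ) 1 ∧ ∀ y' ∈ Set.Ico (0 : ℝ) 1,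
      |y - y'| ≤ x.2.1 * |x.1 y - x.1 y'| ∧ |y - y'| ≤ (2 - (1 / 2) ^ k) * |x.1 y - x.1 y'| ^ s
  -- later displacements sum to at most the current radius, and the new balls lie in `E k`
  let R : ℕ → (ℝ → ℝ) × ℝ × ℝ → (ℝ → ℝ) × ℝ × ℝ → Prop := fun k x x' => x'.2.2 ≤ x.2.2 / 2 ∧
    ∀ y ∈ Set.Ico (0 : ℝ) 1, |x.1 y - x'.1 y| ≤ x.2.2 / 2 ∧
      Metric.closedBall (x'.1 y) x'.2.2 ⊆ E k
  have step : ∀ k x, P k x → ∃ x', P (k + 1) x' ∧ R k x x' := by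
    rintro k ⟨z, L, ρ₀⟩ ⟨hρ₀, hL, hz⟩
    dsimp only at hρ₀ hL hz
    have hpow : (0 : ℝ) < (1 / 2) ^ k := by positivity
    have hpow1 : ((1 : ℝ) / 2) ^ k ≤ 1 := pow_le_one₀ (by norm_num) (by norm_num)
    have hpow2 : ((1 : ℝ) / 2) ^ (k + 1) = (1 / 2) ^ k / 2 := by rw [pow_succ]; ring
    obtain ⟨δ, ρ, q, hρ, hρδ, hδε, hΛ, hq⟩ := hE k (L * (2 * (2 - (1 / 2) ^ k) /
      ((2 - (1 / 2) ^ (k + 1)) - (2 - (1 / 2) ^ k)) + 2)) (ρ₀ / 2) (by linarith)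
    have hδ0 : 0 < δ := hρ.trans_le hρδ
    refine ⟨(fun y => q (z y), L * (δ / ρ), ρ), ⟨hρ, by positivity, fun y hy => ?_⟩,
      by dsimp only; linarith, fun y hy => ?_⟩
    · have hzy := (hz y hy).1
      refine ⟨(hq _ hzy).1, fun y' hy' => ?_⟩
      have hzy' := (hz y' hy').1
      obtain ⟨hDL, hDC⟩ := (hz y hy).2 y' hy'
      have h1 := (hq _ hzy).2.2.2 _ hzy'
      have h2 : |z y - z y'| ≤ |q (z y) - q (z y')| + 2 * δ := by
        have h3 := (hq _ hzy).2.1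
        have h4 := (hq _ hzy').2.1
        rw [abs_le] at h3 h4
        have h5 := neg_abs_le (q (z y) - q (z y'))
        have h6 := le_abs_self (q (z y) - q (z y'))
        rw [abs_le]
        constructor <;> linarith
      dsimp only
      constructor
      · refine hDL.trans ?_
        rw [mul_assoc]
        refine mul_le_mul_of_nonneg_left ?_ hL
        rw [div_mul_eq_mul_div, le_div_iff₀ hρ]
        linarith
      · exact le_mul_rpow_of_concentration hs0 hs1 hL (by linarith) (by linarith)
          (by linarith) hρ hρδ hΛ (abs_nonneg _) (abs_nonneg _) h1 h2 hDL hDC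
    · have hzy := (hz y hy).1
      dsimp only
      rw [abs_sub_comm]
      exact ⟨(hq _ hzy).2.1.trans hδε, (hq _ hzy).2.2.1⟩
  have init : P 0 (id, 1, 1) := by
    refine ⟨one_pos, zero_le_one, fun y hy => ⟨hy, fun y' hy' => ⟨by simp, ?_⟩⟩⟩
    have h1 : |y - y'| ≤ 1 := by
      rw [abs_le]; constructor <;> linarith [hy.1, hy.2, hy'.1, hy'.2]
    have : |y - y'| ^ (1 : ℝ) ≤ |y - y'| ^ s := by
      rcases (abs_nonneg (y - y')).eq_or_lt with h0 | h0
      · rw [← h0, Real.zero_rpow one_ne_zero, Real.zero_rpow hs0.ne']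
      · exact Real.rpow_le_rpow_of_exponent_ge h0 h1 hs1
    rw [Real.rpow_one] at this
    simp only [id, pow_zero]
    linarith
  choose next hnextP hnextR using step
  let X : (k : ℕ) → {x // P k x} := fun k =>
    Nat.rec ⟨_, init⟩ (fun k x => ⟨next k x.1 x.2, hnextP k x.1 x.2⟩) k
  have hR : ∀ k, R k (X k).1 (X (k + 1)).1 := fun k => hnextR k _ _
  let z : ℕ → ℝ → ℝ := fun k => (X k).1.1
  let ρ : ℕ → ℝ := fun k => (X k).1.2.2
  have hρle : ∀ k n, ρ (k + n) ≤ ρ k / 2 ^ n := by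
    intro k n
    induction n with
    | zero => simp
    | succ n ih =>
      have h1 : ρ (k + n + 1) ≤ ρ (k + n) / 2 := (hR (k + n)).1
      rw [← add_assoc, pow_succ, ← div_div]
      linarith
  have hdist : ∀ y ∈ Set.Ico (0 : ℝ) 1, ∀ k n,
      dist (z (k + n) y) (z (k + (n + 1)) y) ≤ ρ k / 2 / 2 ^ n := by
    intro y hy k n
    have h1 : |z (k + n) y - z (k + n + 1) y| ≤ ρ (k + n) / 2 := ((hR (k + n)).2 y hy).1
    rw [Real.dist_eq, ← add_assoc, div_right_comm]
    linarith [hρle k n]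
  have hlim : ∀ y : ℝ, ∃ a, y ∈ Set.Ico (0 : ℝ) 1 → Tendsto (fun k => z k y) atTop (𝓝 a) := by
    intro y
    by_cases hy : y ∈ Set.Ico (0 : ℝ) 1
    · have hc : CauchySeq (fun n => z n y) := by
        refine cauchySeq_of_le_geometric_two (C := ρ 0) fun n => ?_
        simpa using hdist y hy 0 n
      obtain ⟨a, ha⟩ := cauchySeq_tendsto_of_complete hc
      exact ⟨a, fun _ => ha⟩
    · exact ⟨0, fun h => absurd h hy⟩
  choose F hF using hlim
  refine ⟨F, fun y hy => ⟨fun k => ?_, fun y' hy' => ?_⟩⟩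
  · have h1 : Tendsto (fun n => z (k + 1 + n) y) atTop (𝓝 (F y)) := by
      have := (hF y hy).comp (tendsto_add_atTop_nat (k + 1))
      refine this.congr fun n => ?_
      simp [add_comm]
    have h2 := dist_le_of_le_geometric_two_of_tendsto₀ (C := ρ (k + 1))
      (fun n => hdist y hy (k + 1) n) h1
    refine ((hR k).2 y hy).2 ?_
    rw [Metric.mem_closedBall, dist_comm]
    exact h2
  · have h1 : Tendsto (fun k => 2 * |z k y - z k y'| ^ s) atTop (𝓝 (2 * |F y - F y'| ^ s)) :=
      ((((hF y hy).sub (hF y' hy')).abs).rpow_const (Or.inr hs0.le)).const_mul 2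
    refine ge_of_tendsto' h1 fun k => ?_
    refine (((X k).2.2.2 y hy).2 y' hy').2.trans ?_
    refine mul_le_mul_of_nonneg_right ?_ (Real.rpow_nonneg (abs_nonneg _) s)
    have : (0 : ℝ) < (1 / 2) ^ k := by positivity
    linarith

/-- A set containing the image of `[0, 1)` under a map with inverse Hölder of exponent `s` has
positive `s`-dimensional Hausdorff measure. -/
theorem hausdorffMeasure_ne_zero_of_inverse_holder {s : ℝ} (hs0 : 0 < s) {S : Set ℝ} {F : ℝ → ℝ}
    (hF : ∀ y ∈ Set.Ico (0 : ℝ) 1, F y ∈ S ∧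
      ∀ y' ∈ Set.Ico (0 : ℝ) 1, |y - y'| ≤ 2 * |F y - F y'| ^ s) :
    μH[s] S ≠ 0 := by
  intro h0
  have hinj : Set.InjOn F (Set.Ico 0 1) := by
    intro y hy y' hy' h
    have := (hF y hy).2 y' hy'
    rw [h, sub_self, abs_zero, Real.zero_rpow hs0.ne', mul_zero] at this
    linarith [abs_nonpos_iff.1 this]
  let G := Function.invFunOn F (Set.Ico 0 1)
  have hG : ∀ y ∈ Set.Ico (0 : ℝ) 1, G (F y) = y := fun y hy => hinj.leftInvOn_invFunOn hy
  have hHol : HolderOnWith 2 (NNReal.mk s hs0.le) G (F '' Set.Ico 0 1) := by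
    rintro _ ⟨y, hy, rfl⟩ _ ⟨y', hy', rfl⟩
    rw [hG y hy, hG y' hy', edist_dist, edist_dist, Real.dist_eq, Real.dist_eq,
      NNReal.coe_mk, ENNReal.ofReal_rpow_of_nonneg (abs_nonneg _) hs0.le]
    have := ENNReal.ofReal_le_ofReal ((hF y hy).2 y' hy')
    rw [ENNReal.ofReal_mul zero_le_two] at this
    simpa using this
  have himg : G '' (F '' Set.Ico 0 1) = Set.Ico 0 1 := hinj.leftInvOn_invFunOn.image_image
  have h1 := hHol.hausdorffMeasure_image_le hs0 zero_le_one
  rw [himg, hausdorffMeasure_real, Real.volume_Ico, mul_one, NNReal.coe_mk,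
    measure_mono_null (by rintro _ ⟨y, hy, rfl⟩; exact (hF y hy).1) h0] at h1
  simp at h1

/-! ### Concentrations on returning points -/

/-- A full cylinder of order `n` contains an interval of points that return at time `n`, next to the
fixed point of the affine branch of `T_β^n`. This fixed point may lie anywhere in the closed
cylinder, so the interval is taken on the side facing the midpoint. -/
theorem exists_interval_of_isFullCylinder {β : ℝ} (hβ : 1 < β) {n : ℕ} (hn : 1 ≤ n) {τ : ℝ}
    (hτ : 0 ≤ τ) {a ρ : ℝ} (ha : 0 ≤ a) (ha1 : a + (β ^ n)⁻¹ ≤ 1) (hfull : IsFullCylinder β n a)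
    (hρ : ρ = (β ^ n) ^ (-(1 + τ)) / 8) :
    ∃ p, a ≤ p ∧ p + ρ ≤ a + (β ^ n)⁻¹ ∧ ∀ x ∈ Set.Icc (p - ρ) (p + 2 * ρ),
      x ∈ Set.Ico (0 : ℝ) 1 ∧ |(betaMap β)^[n] x - x| < (β ^ n) ^ (-τ) := by
  have hB1 : 1 < β ^ n := one_lt_pow₀ hβ (by omega)
  have hB0 : 0 < β ^ n := by linarith
  unfold IsFullCylinder at hfull
  set B := β ^ n with hB
  have hw0 : 0 < B ^ (-τ) := Real.rpow_pos_of_pos hB0 _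
  have hw1 : B ^ (-τ) ≤ 1 := Real.rpow_le_one_of_one_le_of_nonpos hB1.le (by linarith)
  rw [neg_add, Real.rpow_add hB0, Real.rpow_neg_one] at hρ
  set w := B ^ (-τ) with hw
  have hBi : 0 < B⁻¹ := inv_pos.2 hB0
  have hBB : B * B⁻¹ = 1 := mul_inv_cancel₀ hB0.ne'
  have hρ0 : 0 < ρ := by rw [hρ]; positivity
  have hρB : 8 * ρ ≤ B⁻¹ := by
    rw [hρ]; nlinarith
  -- the fixed point of `x ↦ B * (x - a)`
  set x₀ := a * B / (B - 1) with hx₀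
  have hx₀eq : (B - 1) * x₀ = a * B := by rw [hx₀]; field_simp [(by linarith : B - 1 ≠ 0)]
  have hax : a ≤ x₀ := by
    rw [hx₀, le_div_iff₀ (by linarith)]; nlinarith
  have hxa : x₀ ≤ a + B⁻¹ := by
    rw [hx₀, div_le_iff₀ (by linarith)]; nlinarith
  have key : ∀ x ∈ Set.Ico a (a + B⁻¹), |x - x₀| ≤ 4 * ρ →
      x ∈ Set.Ico (0 : ℝ) 1 ∧ |(betaMap β)^[n] x - x| < w := by
    intro x hx hxρ
    refine ⟨⟨ha.trans hx.1, hx.2.trans_le ha1⟩, ?_⟩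
    rw [hfull x hx, show B * (x - a) - x = (B - 1) * (x - x₀) by rw [mul_sub (B - 1), hx₀eq]; ring,
      abs_mul, abs_of_pos (by linarith)]
    have h4 : B * (4 * ρ) = w / 2 := by
      rw [hρ]; field_simp; norm_num
    calc (B - 1) * |x - x₀| ≤ B * (4 * ρ) :=
          mul_le_mul (by linarith) hxρ (abs_nonneg _) hB0.le
      _ < w := by linarith
  rcases le_total x₀ (a + B⁻¹ / 2) with h | h
  · refine ⟨x₀ + ρ, by linarith, by linarith, fun x hx => key x ⟨?_, ?_⟩ ?_⟩
    · linarith [hx.1]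
    · linarith [hx.2]
    · rw [abs_le]; constructor <;> linarith [hx.1, hx.2]
  · refine ⟨x₀ - 3 * ρ, by linarith, by linarith, fun x hx => key x ⟨?_, ?_⟩ ?_⟩
    · linarith [hx.1]
    · linarith [hx.2]
    · rw [abs_le]; constructor <;> linarith [hx.1, hx.2]

/-- Mapping each cell `[i / M, (i + 1) / M)` affinely onto an interval of length `ρ` inside it gives
a concentration. -/
theorem isConcentration_of_cells {E : Set ℝ} {ρ : ℝ} {M : ℕ} (hM : 0 < M) (hρ : 0 < ρ)
    (hρM : ρ ≤ 1 / M) {p : ℕ → ℝ} (hp : ∀ i < M, (i : ℝ) / M ≤ p i ∧ p i + ρ ≤ (i + 1) / M ∧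
      Set.Icc (p i - ρ) (p i + 2 * ρ) ⊆ E) :
    IsConcentration E (1 / M) ρ (fun y => p ⌊y * M⌋₊ + ρ * (y * M - ⌊y * M⌋₊)) := by
  have hM0 : (0 : ℝ) < M := by exact_mod_cast hM
  have hfl : ∀ y ∈ Set.Ico (0 : ℝ) 1,
      ⌊y * M⌋₊ < M ∧ (⌊y * M⌋₊ : ℝ) ≤ y * M ∧ y * M < ⌊y * M⌋₊ + 1 := by
    intro y hy
    have h0 : 0 ≤ y * M := mul_nonneg hy.1 hM0.le
    refine ⟨(Nat.floor_lt h0).2 ?_, Nat.floor_le h0, Nat.lt_floor_add_one _⟩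
    nlinarith [hy.2]
  have hexp : ∀ y ∈ Set.Ico (0 : ℝ) 1, ∀ y' ∈ Set.Ico (0 : ℝ) 1, y ≤ y' →
      ρ * (y' - y) ≤ 1 / M * ((p ⌊y' * M⌋₊ + ρ * (y' * M - ⌊y' * M⌋₊)) -
        (p ⌊y * M⌋₊ + ρ * (y * M - ⌊y * M⌋₊))) := by
    intro y hy y' hy' hyy
    have hij : ⌊y * M⌋₊ ≤ ⌊y' * M⌋₊ :=
      Nat.floor_le_floor (mul_le_mul_of_nonneg_right hyy hM0.le)
    have hi := hp _ (hfl y hy).1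
    have hj := hp _ (hfl y' hy').1
    have key : ρ * ((⌊y' * M⌋₊ : ℝ) - ⌊y * M⌋₊) ≤ p ⌊y' * M⌋₊ - p ⌊y * M⌋₊ := by
      rcases hij.eq_or_lt with h | h
      · rw [h]; simp
      · have h1 : (⌊y * M⌋₊ : ℝ) + 1 ≤ ⌊y' * M⌋₊ := by exact_mod_cast h
        generalize (⌊y * M⌋₊ : ℝ) = i at *
        generalize (⌊y' * M⌋₊ : ℝ) = j at *
        have h2 : (j - i - 1) * ρ ≤ (j - i - 1) * (1 / M) :=
          mul_le_mul_of_nonneg_left hρM (by linarith)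
        have h3 : j / M - (i + 1) / M = (j - i - 1) * (1 / M) := by ring
        linarith [hi.2.1, hj.1]
    rw [div_mul_eq_mul_div, one_mul, le_div_iff₀ hM0]
    linarith
  intro y hy
  obtain ⟨hlt, h1, h2⟩ := hfl y hy
  obtain ⟨hp1, hp2, hp3⟩ := hp _ hlt
  have hi1 : ((⌊y * M⌋₊ : ℝ) + 1) / M ≤ 1 := by
    rw [div_le_one hM0]; exact_mod_cast hlt
  have hi0 : (0 : ℝ) ≤ (⌊y * M⌋₊ : ℝ) / M := by positivity
  have hfr0 : 0 ≤ ρ * (y * M - ⌊y * M⌋₊) := mul_nonneg hρ.le (by linarith)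
  have hfr1 : ρ * (y * M - ⌊y * M⌋₊) < ρ := by nlinarith
  have hyl : (⌊y * M⌋₊ : ℝ) / M ≤ y := (div_le_iff₀ hM0).2 h1
  have hyr : y ≤ ((⌊y * M⌋₊ : ℝ) + 1) / M := (le_div_iff₀ hM0).2 h2.le
  dsimp only
  refine ⟨⟨by linarith, by linarith⟩, ?_, ?_, fun y' hy' => ?_⟩
  · rw [add_div] at hp2 hyr
    rw [abs_le]
    constructor <;> linarith
  · refine Set.Subset.trans ?_ hp3
    rw [Real.closedBall_eq_Icc]
    exact Set.Icc_subset_Icc (by linarith) (by linarith)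
  · rcases le_total y y' with h | h
    · rw [abs_sub_comm, abs_of_nonneg (by linarith)]
      refine (hexp y hy y' hy' h).trans (mul_le_mul_of_nonneg_left ?_ (by positivity))
      rw [abs_sub_comm]
      exact le_abs_self _
    · rw [abs_of_nonneg (by linarith)]
      exact (hexp y' hy' y hy h).trans
        (mul_le_mul_of_nonneg_left (le_abs_self _) (by positivity))

/-- Concentrations on the points that return at some time `n ≥ k`: the cells have length about
`n β⁻ⁿ`, so each contains a full cylinder of order `n`. -/
theorem exists_isConcentration {β : ℝ} (hβ : 1 < β) {τ s : ℝ} (hτ : 0 ≤ τ) (hs1 : s ≤ 1)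
    (hτs : (1 + τ) * s < 1) (k : ℕ) (Λ : ℝ) {ε : ℝ} (hε : 0 < ε) :
    ∃ δ ρ q, 0 < ρ ∧ ρ ≤ δ ∧ δ ≤ ε ∧ Λ * δ ≤ ρ ^ s ∧ IsConcentration
      {x | x ∈ Set.Ico (0 : ℝ) 1 ∧ ∃ n ≥ k, |(betaMap β)^[n] x - x| < (β ^ n) ^ (-τ)} δ ρ q := by
  have hβ0 : 0 < β := by linarith
  have hlim : ∀ c : ℝ, 0 ≤ c → c < 1 →
      Tendsto (fun n : ℕ => ((n : ℝ) + 2) * c ^ n) atTop (𝓝 0) := by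
    intro c h0 h1
    have h2 := (tendsto_self_mul_const_pow_of_lt_one h0 h1).add
      ((tendsto_pow_atTop_nhds_zero_of_lt_one h0 h1).const_mul 2)
    simp only [mul_zero, add_zero] at h2
    exact h2.congr fun n => by ring
  -- `γ ^ n` is the ratio of `β⁻ⁿ` to `β^(-n(1 + τ)s)`, which up to constants is `ρ^s`
  set γ := β ^ ((1 + τ) * s - 1) with hγ
  have hγ0 : 0 < γ := Real.rpow_pos_of_pos hβ0 _
  have hγ1 : γ < 1 := Real.rpow_lt_one_of_one_lt_of_neg hβ (by linarith)
  have ev1 : ∀ᶠ n : ℕ in atTop, ((n : ℝ) + 2) * β⁻¹ ^ n < min 1 (ε / 2) :=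
    (hlim β⁻¹ (by positivity) (inv_lt_one_of_one_lt₀ hβ)).eventually_lt_const
      (lt_min one_pos (by linarith))
  have ev2 : ∀ᶠ n : ℕ in atTop, 2 * |Λ| * (((n : ℝ) + 2) * γ ^ n) < 1 / 8 := by
    have h := (hlim γ hγ0.le hγ1).const_mul (2 * |Λ|)
    rw [mul_zero] at h
    exact h.eventually_lt_const (by norm_num)
  obtain ⟨n, hn1, hn2, hnk⟩ := (ev1.and (ev2.and (eventually_ge_atTop (max k 1)))).exists
  have hn : 1 ≤ n := (le_max_right _ _).trans hnk
  replace hnk : k ≤ n := (le_max_left _ _).trans hnk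
  have hB0 : 0 < β ^ n := by positivity
  have hB1 : 1 ≤ β ^ n := one_le_pow₀ hβ.le
  rw [inv_pow, lt_min_iff] at hn1
  have hfull := fun u v hu hv => exists_isFullCylinder hβ n (u := u) (v := v) hu hv
  have hint := fun a ha ha1 hf => exists_interval_of_isFullCylinder hβ hn hτ (a := a) ha ha1 hf rfl
  have hγn : (β ^ n) ^ ((1 + τ) * s - 1) = γ ^ n := by
    rw [hγ, ← Real.rpow_natCast, ← Real.rpow_natCast, ← Real.rpow_mul hβ0.le,
      ← Real.rpow_mul hβ0.le, mul_comm]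
  set ρ := (β ^ n) ^ (-(1 + τ)) / 8 with hρ
  have hρ0 : 0 < ρ := by positivity
  have hn0 : (0 : ℝ) < (n : ℝ) + 2 := by positivity
  set M := ⌊β ^ n / (n + 2)⌋₊ with hMdef
  have hx1 : 1 < β ^ n / (n + 2) := by
    rw [lt_div_iff₀ hn0, one_mul]
    have := hn1.1
    rwa [← div_eq_mul_inv, div_lt_one hB0] at this
  have hM : 0 < M := Nat.floor_pos.2 hx1.le
  have hM1 : (1 : ℝ) ≤ M := by exact_mod_cast hM
  have hM0 : (0 : ℝ) < M := by linarith
  have hMle : (M : ℝ) ≤ β ^ n / (n + 2) := Nat.floor_le (by linarith)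
  have hMlt : β ^ n / (n + 2) < M + 1 := Nat.lt_floor_add_one _
  have hδl : (n + 2) * (β ^ n)⁻¹ ≤ 1 / M := by
    rw [le_div_iff₀ hM0, ← div_eq_mul_inv, div_mul_eq_mul_div, div_le_one hB0, mul_comm]
    exact (le_div_iff₀ hn0).1 hMle
  have hδu : 1 / (M : ℝ) ≤ 2 * ((n + 2) * (β ^ n)⁻¹) := by
    have h1 : β ^ n ≤ (2 * M) * (n + 2) := (div_le_iff₀ hn0).1 (by linarith)
    rw [div_le_iff₀ hM0]
    calc (1 : ℝ) = β ^ n * (β ^ n)⁻¹ := (mul_inv_cancel₀ hB0.ne').symm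
      _ ≤ (2 * M) * (n + 2) * (β ^ n)⁻¹ := mul_le_mul_of_nonneg_right h1 (by positivity)
      _ = _ := by ring
  have hρM : ρ ≤ 1 / M := by
    have h1 : (β ^ n) ^ (-(1 + τ)) ≤ (β ^ n) ^ (-1 : ℝ) :=
      Real.rpow_le_rpow_of_exponent_le hB1 (by linarith)
    rw [Real.rpow_neg_one] at h1
    have h2 : 0 < (β ^ n)⁻¹ := by positivity
    have h3 : (0 : ℝ) ≤ n * (β ^ n)⁻¹ := by positivity
    linarith
  have hcell : ∀ i : ℕ, ∃ p, i < M → (i : ℝ) / M ≤ p ∧ p + ρ ≤ (i + 1) / M ∧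
      Set.Icc (p - ρ) (p + 2 * ρ) ⊆
        {x | x ∈ Set.Ico (0 : ℝ) 1 ∧ ∃ n ≥ k, |(betaMap β)^[n] x - x| < (β ^ n) ^ (-τ)} := by
    intro i
    by_cases hi : i < M
    · have hi1 : ((i : ℝ) + 1) / M ≤ 1 := by rw [div_le_one hM0]; exact_mod_cast hi
      have hi0 : (0 : ℝ) ≤ (i : ℝ) / M := by positivity
      obtain ⟨a, ha0, ha1, hf⟩ := hfull (i / M) ((i + 1) / M) hi0 hi1 (by
        have : 0 < (β ^ n)⁻¹ := by positivity
        rw [add_div, add_sub_cancel_left]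
        linarith)
      obtain ⟨p, hp0, hp1, hp⟩ := hint a (hi0.trans ha0) (ha1.trans hi1) hf
      exact ⟨p, fun _ => ⟨ha0.trans hp0, hp1.trans ha1,
        fun x hx => ⟨(hp x hx).1, n, hnk, (hp x hx).2⟩⟩⟩
    · exact ⟨0, fun h => absurd h hi⟩
  choose p hp using hcell
  refine ⟨1 / M, ρ, _, hρ0, hρM, by linarith [hn1.2], ?_, isConcentration_of_cells hM hρ0 hρM hp⟩
  have h8 : (8 : ℝ) ^ s ≤ 8 := by
    conv_rhs => rw [← Real.rpow_one 8]
    exact Real.rpow_le_rpow_of_exponent_le (by norm_num) hs1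
  have hw0 : 0 < (β ^ n) ^ (-((1 + τ) * s)) := Real.rpow_pos_of_pos hB0 _
  calc Λ * (1 / M) ≤ |Λ| * (2 * ((n + 2) * (β ^ n)⁻¹)) :=
        mul_le_mul (le_abs_self _) hδu (by positivity) (abs_nonneg _)
    _ = 2 * |Λ| * ((n + 2) * γ ^ n) * (β ^ n) ^ (-((1 + τ) * s)) := by
        have : (β ^ n)⁻¹ = γ ^ n * (β ^ n) ^ (-((1 + τ) * s)) := by
          rw [← hγn, ← Real.rpow_add hB0, ← Real.rpow_neg_one]
          congr 1
          ring
        rw [this]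
        ring
    _ ≤ 1 / 8 * (β ^ n) ^ (-((1 + τ) * s)) := mul_le_mul_of_nonneg_right hn2.le hw0.le
    _ ≤ (β ^ n) ^ (-((1 + τ) * s)) / 8 ^ s := by
        rw [one_div_mul_eq_div]
        exact div_le_div_of_nonneg_left hw0.le (by positivity) h8
    _ = ρ ^ s := by
        rw [hρ, Real.div_rpow (by positivity) (by norm_num), ← Real.rpow_mul hB0.le, neg_mul]

/-! ### Dimension of the level sets -/

theorem mem_returnSet_of_lt_recurrenceExponent {β : ℝ} (hβ : 1 < β) {t : ℝ} (ht : 0 ≤ t) {x : ℝ}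
    (hx : x ∈ Set.Ico (0 : ℝ) 1) (h : ENNReal.ofReal t < recurrenceExponent β x) :
    x ∈ returnSet β t := by
  obtain ⟨r, hr, htr⟩ := lt_sSup_iff.1 h
  refine ⟨hx, Set.Infinite.mono
    (fun n (hn : |(betaMap β)^[n] x - x| < negPow (β ^ n) r) => hn.trans_le ?_) hr⟩
  unfold negPow
  split_ifs with hr_top
  · positivity
  · have h1 : t ≤ r.toReal := by
      rw [← ENNReal.toReal_ofReal ht]
      exact (ENNReal.toReal_lt_toReal ENNReal.ofReal_ne_top hr_top).2 htr |>.le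
    exact Real.rpow_le_rpow_of_exponent_le (one_le_pow₀ hβ.le) (by linarith)

theorem le_recurrenceExponent {β r x : ℝ} (h : ∀ t, 0 ≤ t → t < r → x ∈ returnSet β t) :
    ENNReal.ofReal r ≤ recurrenceExponent β x := by
  by_contra! hlt
  obtain ⟨c, hc1, hc2⟩ := exists_between hlt
  have hc : c ≠ ∞ := ne_top_of_lt hc2
  refine absurd hc1 (not_lt.2 (le_sSup ?_))
  have := (h c.toReal ENNReal.toReal_nonneg ((ENNReal.lt_ofReal_iff_toReal_lt hc).1 hc2)).2
  simpa [negPow, hc] using this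

/-- At the critical exponent `1 / (1 + r)` the points with recurrence exponent at least `r` have
positive Hausdorff measure. -/
theorem hausdorffMeasure_le_recurrenceExponent_ne_zero {β : ℝ} (hβ : 1 < β) {r : ℝ} (hr : 0 ≤ r) :
    μH[1 / (1 + r)] {x | x ∈ Set.Ico (0 : ℝ) 1 ∧ ENNReal.ofReal r ≤ recurrenceExponent β x} ≠
      0 := by
  have hs0 : 0 < 1 / (1 + r) := by positivity
  rcases hr.eq_or_lt with rfl | hr0
  · refine hausdorffMeasure_ne_zero_of_inverse_holder (F := id) hs0 fun y hy =>
      ⟨⟨hy, by simp⟩, fun y' _ => ?_⟩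
    simp only [id, add_zero, div_one, Real.rpow_one]
    linarith [abs_nonneg (y - y')]
  have hs1 : 1 / (1 + r) ≤ 1 := (div_le_one (by linarith)).2 (by linarith)
  -- exponents below `r` tending to it: each leaves room for a factor exponential in `n`
  let τ : ℕ → ℝ := fun k => r - r / (k + 1)
  have hτ0 : ∀ k, 0 ≤ τ k := fun k => by
    have : r / ((k : ℝ) + 1) ≤ r := div_le_self hr (by linarith [(Nat.cast_nonneg k : (0 : ℝ) ≤ k)])
    simp only [τ]; linarith
  have hτr : ∀ k, τ k < r := fun k => by
    have : 0 < r / ((k : ℝ) + 1) := by positivity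
    simp only [τ]; linarith
  obtain ⟨F, hF⟩ := exists_inverse_holder_map hs0 hs1
    (fun k => {x | x ∈ Set.Ico (0 : ℝ) 1 ∧ ∃ n ≥ k, |(betaMap β)^[n] x - x| < (β ^ n) ^ (-τ k)})
    fun k Λ ε hε => exists_isConcentration hβ (hτ0 k) hs1
      (by rw [mul_one_div, div_lt_one (by linarith)]; linarith [hτr k]) k Λ hε
  refine hausdorffMeasure_ne_zero_of_inverse_holder hs0 fun y hy => ⟨⟨((hF y hy).1 0).1, ?_⟩,
    (hF y hy).2⟩
  refine le_recurrenceExponent fun t _ htr => ⟨((hF y hy).1 0).1, ?_⟩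
  obtain ⟨K, hK⟩ := exists_nat_ge (r / (r - t))
  refine Set.infinite_of_forall_exists_gt fun N => ?_
  obtain ⟨-, n, hn, hlt⟩ := (hF y hy).1 (max K (N + 1))
  refine ⟨n, hlt.trans_le ?_, by have := le_max_right K (N + 1); omega⟩
  refine Real.rpow_le_rpow_of_exponent_le (one_le_pow₀ hβ.le) (neg_le_neg ?_)
  have h1 : (K : ℝ) ≤ (max K (N + 1) : ℕ) := by exact_mod_cast le_max_left K (N + 1)
  have h2 : r / (((max K (N + 1) : ℕ) : ℝ) + 1) ≤ r - t := by
    rw [div_le_iff₀ (by positivity)]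
    rw [div_le_iff₀ (by linarith)] at hK
    nlinarith
  simp only [τ]
  linarith

theorem dimH_recurrenceExponent_le {β : ℝ} (hβ : 1 < β) (r : ℝ≥0∞) :
    dimH {x : ℝ | x ∈ Set.Ico (0 : ℝ) 1 ∧ recurrenceExponent β x = r} ≤ 1 / (1 + r) := by
  rcases eq_or_ne r 0 with rfl | hr0
  · simpa using (dimH_mono (Set.subset_univ _)).trans_eq Real.dimH_univ
  refine le_of_forall_gt_imp_ge_of_dense fun d hd => ?_
  rcases eq_or_ne d ∞ with rfl | hd_top
  · exact le_top
  lift d to NNReal using hd_top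
  have hd0 : (0 : ℝ) < d := by
    have : (0 : ℝ≥0∞) < d := lt_of_le_of_lt zero_le hd
    exact_mod_cast this
  obtain ⟨t, ht0, htr, htd⟩ : ∃ t : ℝ, 0 ≤ t ∧ ENNReal.ofReal t < r ∧ 1 < (1 + t) * d := by
    rcases eq_or_ne r ∞ with rfl | hr_top
    · refine ⟨1 / d, by positivity, ENNReal.ofReal_lt_top, ?_⟩
      rw [add_mul, one_div_mul_cancel hd0.ne']
      linarith
    · lift r to NNReal using hr_top
      have hr0' : (0 : ℝ) < r := by
        have : r ≠ 0 := by exact_mod_cast hr0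
        exact_mod_cast pos_iff_ne_zero.2 this
      have hd' : 1 / (1 + (r : ℝ)) < d := by
        have : (1 / (1 + r) : NNReal) < d := by
          rw [← ENNReal.coe_lt_coe, ENNReal.coe_div (by positivity)]
          exact_mod_cast hd
        exact_mod_cast this
      rw [div_lt_iff₀ (by positivity)] at hd'
      have h1 : 1 / (d : ℝ) - 1 < r := by
        rw [sub_lt_iff_lt_add, div_lt_iff₀ hd0]; linarith
      obtain ⟨t, ht1, ht2⟩ := exists_between (max_lt hr0' h1)
      rw [max_lt_iff] at ht1
      refine ⟨t, ht1.1.le, ?_, ?_⟩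
      · rw [← ENNReal.ofReal_coe_nnreal]
        exact (ENNReal.ofReal_lt_ofReal_iff hr0').2 ht2
      · have := ht1.2
        rw [sub_lt_iff_lt_add, div_lt_iff₀ hd0] at this
        linarith
  refine dimH_le_of_hausdorffMeasure_ne_top (ne_top_of_le_ne_top ENNReal.zero_ne_top ?_)
  rw [← hausdorffMeasure_returnSet hβ ht0 htd]
  refine measure_mono fun x hx => ?_
  exact mem_returnSet_of_lt_recurrenceExponent hβ ht0 hx.1 (by rw [hx.2]; exact htr)

/-- The points of exponent greater than `r` are negligible at the critical exponent, so the positive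
measure sits on the level set itself. -/
theorem le_dimH_recurrenceExponent {β : ℝ} (hβ : 1 < β) (r : ℝ≥0∞) :
    1 / (1 + r) ≤ dimH {x : ℝ | x ∈ Set.Ico (0 : ℝ) 1 ∧ recurrenceExponent β x = r} := by
  rcases eq_or_ne r ∞ with rfl | hr_top
  · simp
  lift r to NNReal using hr_top
  have hcoe : (1 / (1 + (r : ℝ≥0∞))) = ((1 / (1 + r) : NNReal) : ℝ≥0∞) := by
    rw [ENNReal.coe_div (by positivity)]; simp
  rw [hcoe]
  refine le_dimH_of_hausdorffMeasure_ne_zero fun h0 => ?_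
  refine hausdorffMeasure_le_recurrenceExponent_ne_zero hβ r.2 ?_
  have hnull : ∀ j : ℕ, μH[1 / (1 + (r : ℝ))] (returnSet β (r + 1 / (j + 1))) = 0 := by
    intro j
    have hj : (0 : ℝ) < 1 / ((j : ℝ) + 1) := by positivity
    refine hausdorffMeasure_returnSet hβ (by positivity) ?_
    rw [mul_one_div, one_lt_div (by positivity)]
    linarith
  have hsub : {x | x ∈ Set.Ico (0 : ℝ) 1 ∧ ENNReal.ofReal r ≤ recurrenceExponent β x} ⊆
      {x : ℝ | x ∈ Set.Ico (0 : ℝ) 1 ∧ recurrenceExponent β x = r} ∪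
        ⋃ j : ℕ, returnSet β (r + 1 / (j + 1)) := by
    rintro x ⟨hx, hle⟩
    rw [ENNReal.ofReal_coe_nnreal] at hle
    rcases hle.eq_or_lt with h | h
    · exact Or.inl ⟨hx, h.symm⟩
    · right
      obtain ⟨c, hc1, hc2⟩ := ENNReal.lt_iff_exists_nnreal_btwn.1 h
      have hc1' : (r : ℝ) < c := by exact_mod_cast hc1
      obtain ⟨j, hj⟩ := exists_nat_one_div_lt (sub_pos.2 hc1')
      refine Set.mem_iUnion.2 ⟨j, mem_returnSet_of_lt_recurrenceExponent hβ (by positivity) hx ?_⟩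
      refine lt_of_le_of_lt ?_ hc2
      rw [← ENNReal.ofReal_coe_nnreal]
      exact ENNReal.ofReal_le_ofReal (by linarith)
  refine measure_mono_null hsub (measure_union_null ?_ (measure_iUnion_null hnull))
  simpa using h0

end BetaRecurrence

theorem mainTheorem3 (β : ℝ) (hβ : 1 < β) (r : ℝ≥0∞) :
    dimH {x : ℝ | x ∈ Set.Ico (0 : ℝ) 1 ∧ BetaRecurrence.recurrenceExponent β x = r} =
      1 / (1 + r) :=
  le_antisymm (BetaRecurrence.dimH_recurrenceExponent_le hβ r)
    (BetaRecurrence.le_dimH_recurrenceExponent hβ r)
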